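/- **Proposition.** For $\mathbb F\in\{\mathbb Q,\mathbb R\}$ let $\mathcal L_{\mathbb F}$ be the class of finite-dimensional linear spaces over $\mathbb F$, with injective linear maps as embeddings. A *partial automorphism* of a linear space $A$ is a linear isomorphism $f\colon B\to C$ between two linear subspaces $B,C$ of $A$. For $n\in\mathbb N$ let $(\mathcal L_{\mathbb F})_n$ be the class of all systems $(A,f_1\colon B_1\to C_1,\dots,f_n\colon B_n\to C_n)$ with $A\in\mathcal L_{\mathbb F}$ and $f_1,\dots,f_n$ partial automorphisms of $A$. An embedding of $(A,f_i\colon B_i\to C_i)_{i\le n}$ into $(A',f_i'\colon B_i'\to C_i')_{i\le n}$ is an injective linear map $\alpha\colon A\to A'$ such that, for all $i$, $\alpha(B_i)\subseteq B_i'$ and $f_i'(\alpha(x))=\alpha(f_i(x))$ for all $x\in B_i$. 1. $\mathcal L_{\mathbb Q}$ and $\mathcal L_{\mathbb R}$ have the Hrushovski property: for $\mathbb F\in\{\mathbb Q,\mathbb R\}$, every $n\in\mathbb N$, every $A\in\mathcal L_{\mathbb F}$ and all partial automorphisms $f_1,\dots,f_n$ of $A$, there is $B\in\mathcal L_{\mathbb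 F}$ with $A\subseteq B$ (up to a linear embedding of $A$ into $B$) such that every $f_i$ extends to an automorphism of $B$. 2. For every $n\in\mathbb N$ the class $\mathcal K=(\mathcal L_{\mathbb Q})_n$ has the joint embedding property (any two members of $\mathcal K$ embed into a single member of $\mathcal K$) and the weak amalgamation property: for every $A\in\mathcal K$ there are $A'\in\mathcal K$ and an embedding $\varphi\colon A\to A'$ such that for all $B,C\in\mathcal K$ and embeddings $\alpha\colon A'\to B$, $\beta\colon A'\to C$ there are $D\in\mathcal K$ and embeddings $\gamma\colon B\to D$, $\delta\colon C\to D$ with $\gamma\circ\alpha\circ\varphi=\delta\circ\beta\circ\varphi$. 3. Let $V$ be a countable infinite-dimensional linear space over $\mathbb Q$, and let $G=\operatorname{Aut}(V)$ be its group of linear automorphisms, with the topology inherited from $V^V$, where $V$ is discrete. Then $G$ is a Polish group with ample generics: for every $n\in\mathbb N$ the action $g\cdot(g_1,\dots,g_n)=(gg_1g^{-1},\dots,gg_ng^{-1})$ of $G$ on $G^n$ has a comeager orbit. -/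

import Mathlib

universe u v

/-- A partial automorphism of the `F`-linear space `V`: a linear isomorphism `f : B → C` between two
linear subspaces `B`, `C` of `V`. -/
structure PartialLinearAut (F : Type*) [Field F] (V : Type*) [AddCommGroup V] [Module F V] where
  /-- the domain `B` -/
  dom : Submodule F V
  /-- the range `C` -/
  ran : Submodule F V
  /-- the isomorphism `f : B → C` -/
  toEquiv : dom ≃ₗ[F] ran

/-- `n`-Hrushovski property of the class of finite-dimensional linear spaces over `F`: for every
finite-dimensional `A` and all partial automorphisms `f₁, …, fₙ` of `A` there is a finite-dimensional
`B` containing `A` (by way of an injective linear map `ι`) such that every `fᵢ` extends to an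
automorphism of `B`. -/
def HasNHrushovskiProperty (F : Type*) [Field F] (n : ℕ) : Prop :=
  ∀ (A : Type u) [AddCommGroup A] [Module F A] [FiniteDimensional F A]
    (f : Fin n → PartialLinearAut F A),
    ∃ (B : Type u) (_ : AddCommGroup B) (_ : Module F B) (_ : FiniteDimensional F B)
      (ι : A →ₗ[F] B) (g : Fin n → (B ≃ₗ[F] B)), Function.Injective ι ∧
      ∀ (i : Fin n) (x : (f i).dom), g i (ι (x : A)) = ι ((f i).toEquiv x : A)

/-- Hrushovski property: the `n`-Hrushovski property for every `n`. -/
def HasHrushovskiProperty (F : Type*) [Field F] : Prop :=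
  ∀ n : ℕ, HasNHrushovskiProperty.{u} F n

/-- The members `(A, f₁ : B₁ → C₁, …, fₙ : Bₙ → Cₙ)` of the class `𝓛ₙ`, where `𝓛` is the class of
finite-dimensional linear spaces over `F`: a finite-dimensional `A` together with `n` partial
automorphisms of `A`. -/
structure PartialAutSystem (F : Type*) [Field F] (n : ℕ) where
  /-- the underlying linear space `A` -/
  carrier : Type u
  [addCommGroup : AddCommGroup carrier]
  [module : Module F carrier]
  [finiteDimensional : FiniteDimensional F carrier]
  /-- the partial automorphisms `f₁, …, fₙ` -/
  map : Fin n → PartialLinearAut F carrier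

attribute [instance] PartialAutSystem.addCommGroup PartialAutSystem.module
  PartialAutSystem.finiteDimensional

namespace PartialAutSystem

variable {F : Type*} [Field F] {n : ℕ}

/-- Embeddings of `𝓛ₙ`: injective linear maps `α : A → A'` with `α ∘ fᵢ ⊆ fᵢ' ∘ α` for every `i`
(inclusion of partial maps), that is, `α` maps the domain of `fᵢ` into the domain of `fᵢ'`, and
`fᵢ' (α x) = α (fᵢ x)` for every `x` in the domain of `fᵢ`. -/
structure Embedding (S T : PartialAutSystem.{u} F n) where
  /-- the underlying linear map -/
  toLinearMap : S.carrier →ₗ[F] T.carrier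
  injective : Function.Injective toLinearMap
  mem_dom : ∀ (i : Fin n) (x : (S.map i).dom), toLinearMap (x : S.carrier) ∈ (T.map i).dom
  comm : ∀ (i : Fin n) (x : (S.map i).dom),
    ((T.map i).toEquiv ⟨toLinearMap (x : S.carrier), mem_dom i x⟩ : T.carrier)
      = toLinearMap ((S.map i).toEquiv x : S.carrier)

end PartialAutSystem

/-- Joint embedding property of `𝓛ₙ`. -/
def PartialAutSystemsHaveJEP (F : Type*) [Field F] (n : ℕ) : Prop :=
  ∀ A B : PartialAutSystem.{u} F n, ∃ C : PartialAutSystem.{u} F n,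
    Nonempty (A.Embedding C) ∧ Nonempty (B.Embedding C)

/-- Weak amalgamation property of `𝓛ₙ`. -/
def PartialAutSystemsHaveWAP (F : Type*) [Field F] (n : ℕ) : Prop :=
  ∀ A : PartialAutSystem.{u} F n, ∃ (A' : PartialAutSystem.{u} F n) (φ : A.Embedding A'),
    ∀ (B C : PartialAutSystem.{u} F n) (α : A'.Embedding B) (β : A'.Embedding C),
      ∃ (D : PartialAutSystem.{u} F n) (γ : B.Embedding D) (δ : C.Embedding D),
        ∀ x : A.carrier, γ.toLinearMap (α.toLinearMap (φ.toLinearMap x))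
          = δ.toLinearMap (β.toLinearMap (φ.toLinearMap x))

/-- The topology on the automorphism group of the linear space `V` inherited from the product `V ^ V`
of copies of the discrete space `V` (the topology of pointwise convergence). -/
abbrev linearAutTopology (F : Type*) [Field F] (V : Type*) [AddCommGroup V] [Module F V] :
    TopologicalSpace (V ≃ₗ[F] V) :=
  TopologicalSpace.induced (fun (g : V ≃ₗ[F] V) (x : V) => g x)
    (@Pi.topologicalSpace V (fun _ => V) (fun _ => ⊥))

/-- The diagonal conjugacy class of `(g₁, …, gₙ)`: its orbit under the action
`k • (g₁, …, gₙ) = (k g₁ k⁻¹, …, k gₙ k⁻¹)` of `G` on `Gⁿ`. -/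
def diagonalConjClass {G : Type*} [Group G] {n : ℕ} (g : Fin n → G) : Set (Fin n → G) :=
  {h | ∃ k : G, h = fun i => k * g i * k⁻¹}

/-- `G`, with the topology `τ`, is a Polish group with ample generics: for every `n` there is a
comeager diagonal conjugacy class in `Gⁿ`. -/
def IsPolishGroupWithAmpleGenerics (G : Type*) [Group G] (τ : TopologicalSpace G) : Prop :=
  IsTopologicalGroup G ∧ PolishSpace G ∧
    ∀ n : ℕ, ∃ g : Fin n → G, diagonalConjClass g ∈ residual (Fin n → G)

/-! A partial automorphism of a finite-dimensional space extends to an automorphism of the same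
space, because complements of its domain and range have equal dimension. This is the Hrushovski
property, and it makes systems of total automorphisms cofinal among all systems. Total systems embed
jointly in direct sums and amalgamate by pushouts (`exists_amalgam`), which gives JEP and WAP.

For ample generics, call a tuple `g` on `V` generic if it is locally finite (`IsLocallyFiniteTuple`)
and injective for embeddings of finite-dimensional total systems (`HasExtensionProperty`). Each
condition is a countable intersection of dense open ones: openness holds because finitely many
values of the tuple decide it, density because a tuple can be altered outside any finite-dimensional
subspace, by extension of partial maps and by amalgamation. A back-and-forth
(`exists_linearEquiv_conj`) shows any two generic tuples to be conjugate, so a comeager set lies in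
a single diagonal class. -/

section LinearExtension

/-! ### Extension and amalgamation in linear algebra -/

variable {F : Type*} [Field F]

/-- Two injective linear maps from `B` into a finite-dimensional space differ by an automorphism. -/
theorem exists_linearEquiv_comp_eq {A B : Type*} [AddCommGroup A] [Module F A]
    [FiniteDimensional F A] [AddCommGroup B] [Module F B] (j T : B →ₗ[F] A)
    (hj : Function.Injective j) (hT : Function.Injective T) :
    ∃ g : A ≃ₗ[F] A, ∀ x, g (j x) = T x := by
  obtain ⟨P, hP⟩ := Submodule.exists_isCompl (LinearMap.range j)
  obtain ⟨Q, hQ⟩ := Submodule.exists_isCompl (LinearMap.range T)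
  have hPQ : Module.finrank F P = Module.finrank F Q := by
    have h1 := Submodule.finrank_add_eq_of_isCompl hP
    have h2 := Submodule.finrank_add_eq_of_isCompl hQ
    rw [LinearMap.finrank_range_of_inj hj] at h1
    rw [LinearMap.finrank_range_of_inj hT] at h2
    omega
  let e : LinearMap.range j ≃ₗ[F] LinearMap.range T :=
    (LinearEquiv.ofInjective j hj).symm.trans (LinearEquiv.ofInjective T hT)
  refine ⟨(Submodule.prodEquivOfIsCompl _ _ hP).symm.trans
    ((e.prodCongr (LinearEquiv.ofFinrankEq P Q hPQ)).trans
      (Submodule.prodEquivOfIsCompl _ _ hQ)), fun x => ?_⟩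
  have h1 : (Submodule.prodEquivOfIsCompl _ _ hP).symm (j x)
      = (LinearEquiv.ofInjective j hj x, 0) :=
    Submodule.prodEquivOfIsCompl_symm_apply_left _ _ hP (LinearEquiv.ofInjective j hj x)
  simp [h1, e]

/-- A partial automorphism of a finite-dimensional space extends to an automorphism of it. -/
theorem PartialLinearAut.exists_extension {A : Type*} [AddCommGroup A] [Module F A]
    [FiniteDimensional F A] (f : PartialLinearAut F A) :
    ∃ g : A ≃ₗ[F] A, ∀ x : f.dom, g x = f.toEquiv x :=
  exists_linearEquiv_comp_eq f.dom.subtype (f.ran.subtype ∘ₗ f.toEquiv.toLinearMap)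
    f.dom.injective_subtype (f.ran.injective_subtype.comp f.toEquiv.injective)

/-- No enlargement is needed: `B = A` works. -/
theorem hasHrushovskiProperty (F : Type*) [Field F] : HasHrushovskiProperty.{u} F := by
  intro n A _ _ _ f
  choose g hg using fun i => (f i).exists_extension
  exact ⟨A, _, _, ‹_›, LinearMap.id, g, Function.injective_id, hg⟩

/-- An automorphism of a subspace extends to an automorphism of the whole space. -/
theorem exists_linearEquiv_extending_conj {V D : Type*} [AddCommGroup V] [Module F V]
    [AddCommGroup D] [Module F D] (ψ : D →ₗ[F] V) (hψ : Function.Injective ψ) (d : D ≃ₗ[F] D) :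
    ∃ h : V ≃ₗ[F] V, ∀ x, h (ψ x) = ψ (d x) := by
  obtain ⟨Q, hQ⟩ := Submodule.exists_isCompl (LinearMap.range ψ)
  let E : (D × Q) ≃ₗ[F] V := ((LinearEquiv.ofInjective ψ hψ).prodCongr (.refl F Q)).trans
    (Submodule.prodEquivOfIsCompl _ _ hQ)
  have hE (x : D) : E (x, 0) = ψ x := by simp [E]
  refine ⟨E.symm.trans ((d.prodCongr (.refl F Q)).trans E), fun x => ?_⟩
  simp [← hE]

/-- A finite-dimensional extension of a subspace of an infinite-dimensional space `V` embeds in `V`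
over that subspace. -/
theorem exists_injective_comp_eq {V D W : Type*} [AddCommGroup V] [Module F V]
    [AddCommGroup D] [Module F D] [FiniteDimensional F D] [AddCommGroup W] [Module F W]
    (hV : ¬ FiniteDimensional F V) (γ : W →ₗ[F] D) (j : W →ₗ[F] V)
    (hγ : Function.Injective γ) (hj : Function.Injective j) :
    ∃ ψ : D →ₗ[F] V, Function.Injective ψ ∧ ∀ x, ψ (γ x) = j x := by
  have : FiniteDimensional F W := FiniteDimensional.of_injective γ hγ
  obtain ⟨P, hP⟩ := Submodule.exists_isCompl (LinearMap.range γ)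
  obtain ⟨Q, hQ⟩ := Submodule.exists_isCompl (LinearMap.range j)
  have hQinf : ¬ FiniteDimensional F Q := fun h =>
    hV (Module.Finite.equiv (Submodule.prodEquivOfIsCompl _ _ hQ))
  obtain ⟨t, ht⟩ : ∃ t : P →ₗ[F] Q, Function.Injective t := by
    refine Module.Free.exists_linearMap_injective_of_lift_rank_lt ?_
    have h1 : Cardinal.lift (Module.rank F P) < Cardinal.aleph0 :=
      Cardinal.lift_lt_aleph0.2 (Module.rank_lt_aleph0 F P)
    exact h1.trans_le (Cardinal.aleph0_le_lift.2 (not_lt.1 fun h => hQinf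
      (Module.rank_lt_aleph0_iff.1 h)))
  let e : LinearMap.range γ ≃ₗ[F] LinearMap.range j :=
    (LinearEquiv.ofInjective γ hγ).symm.trans (LinearEquiv.ofInjective j hj)
  refine ⟨(Submodule.prodEquivOfIsCompl _ _ hQ).toLinearMap ∘ₗ (e.toLinearMap.prodMap t) ∘ₗ
    (Submodule.prodEquivOfIsCompl _ _ hP).symm.toLinearMap, ?_, fun x => ?_⟩
  · exact (Submodule.prodEquivOfIsCompl _ _ hQ).injective.comp
      ((e.injective.prodMap ht).comp (Submodule.prodEquivOfIsCompl _ _ hP).symm.injective)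
  · have h1 : (Submodule.prodEquivOfIsCompl _ _ hP).symm (γ x)
        = (LinearEquiv.ofInjective γ hγ x, 0) :=
      Submodule.prodEquivOfIsCompl_symm_apply_left _ _ hP (LinearEquiv.ofInjective γ hγ x)
    simp only [LinearMap.comp_apply, LinearEquiv.coe_coe, h1]
    simp [e]

/-- Amalgamation of finite-dimensional spaces with total operators. -/
theorem exists_amalgam {ι : Type*} {A B C : Type*} [AddCommGroup A] [Module F A]
    [AddCommGroup B] [Module F B] [FiniteDimensional F B]
    [AddCommGroup C] [Module F C] [FiniteDimensional F C]
    (α : A →ₗ[F] B) (β : A →ₗ[F] C) (hα : Function.Injective α) (hβ : Function.Injective β)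
    (a : ι → A → A) (b : ι → B ≃ₗ[F] B) (c : ι → C ≃ₗ[F] C)
    (hab : ∀ i x, b i (α x) = α (a i x)) (hac : ∀ i x, c i (β x) = β (a i x)) :
    ∃ (N : Submodule F (B × C)) (d : ι → ((B × C) ⧸ N) ≃ₗ[F] ((B × C) ⧸ N))
      (γ : B →ₗ[F] (B × C) ⧸ N) (δ : C →ₗ[F] (B × C) ⧸ N),
      Function.Injective γ ∧ Function.Injective δ ∧ (∀ x, γ (α x) = δ (β x)) ∧
      (∀ i x, d i (γ x) = γ (b i x)) ∧ ∀ i x, d i (δ x) = δ (c i x) := by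
  -- The quotient by the antidiagonal copy of `A` is the pushout of `B` and `C` over `A`.
  let N : Submodule F (B × C) := LinearMap.range (α.prod (-β))
  have hN (i : ι) : N ≤ N.comap ((b i).toLinearMap.prodMap (c i).toLinearMap) := by
    rintro _ ⟨x, rfl⟩
    exact ⟨a i x, by simp [hab, hac]⟩
  let d₀ (i : ι) := N.mapQ N _ (hN i)
  -- Surjectivity suffices, since the quotient is finite-dimensional.
  have hd (i : ι) : Function.Surjective (d₀ i) := by
    intro y
    obtain ⟨⟨y₁, y₂⟩, rfl⟩ := N.mkQ_surjective y
    exact ⟨N.mkQ ((b i).symm y₁, (c i).symm y₂), by simp [d₀]⟩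
  refine ⟨N, fun i => LinearEquiv.ofBijective (d₀ i)
    ⟨LinearMap.injective_iff_surjective.2 (hd i), hd i⟩, N.mkQ ∘ₗ LinearMap.inl F B C,
    N.mkQ ∘ₗ LinearMap.inr F B C, ?_, ?_, fun x => ?_, fun i x => ?_, fun i x => ?_⟩
  · rw [injective_iff_map_eq_zero]
    intro x hx
    obtain ⟨y, hy⟩ : (x, (0 : C)) ∈ N := by simpa using hx
    simp only [LinearMap.prod_apply, Function.prod_apply, LinearMap.neg_apply, Prod.mk.injEq, neg_eq_zero] at hy
    rw [← hy.1, (injective_iff_map_eq_zero β).1 hβ y hy.2, map_zero]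
  · rw [injective_iff_map_eq_zero]
    intro x hx
    obtain ⟨y, hy⟩ : ((0 : B), x) ∈ N := by simpa using hx
    simp only [LinearMap.prod_apply, Function.prod_apply, LinearMap.neg_apply, Prod.mk.injEq] at hy
    rw [← hy.2, (injective_iff_map_eq_zero α).1 hα y hy.1, map_zero, neg_zero]
  · rw [← sub_eq_zero, LinearMap.comp_apply, LinearMap.comp_apply, ← map_sub]
    simp only [Submodule.mkQ_apply, Submodule.Quotient.mk_eq_zero]
    exact ⟨x, by simp⟩
  · change d₀ i _ = _
    simp [d₀]
  · change d₀ i _ = _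
    simp [d₀]

end LinearExtension

/-! ### Joint embedding and weak amalgamation -/

namespace PartialLinearAut

/-- A total automorphism as a partial one. -/
def ofEquiv {F : Type*} [Field F] {V : Type*} [AddCommGroup V] [Module F V] (g : V ≃ₗ[F] V) :
    PartialLinearAut F V where
  dom := ⊤
  ran := ⊤
  toEquiv := Submodule.topEquiv.trans (g.trans Submodule.topEquiv.symm)

end PartialLinearAut

namespace PartialAutSystem

variable {F : Type*} [Field F] {n : ℕ}

/-- The system of total automorphisms. -/
def total (A : Type u) [AddCommGroup A] [Module F A] [FiniteDimensional F A]
    (g : Fin n → A ≃ₗ[F] A) : PartialAutSystem.{u} F n where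
  carrier := A
  map i := .ofEquiv (g i)

/-- An injective linear map intertwining the partial maps of `S` with total automorphisms. -/
def embeddingTotal (S : PartialAutSystem.{u} F n) {A : Type u} [AddCommGroup A] [Module F A]
    [FiniteDimensional F A] (g : Fin n → A ≃ₗ[F] A) (φ : S.carrier →ₗ[F] A)
    (hφ : Function.Injective φ)
    (h : ∀ i (x : (S.map i).dom), g i (φ x) = φ ((S.map i).toEquiv x)) :
    S.Embedding (total A g) where
  toLinearMap := φ
  injective := hφ
  mem_dom _ _ := trivial
  comm := h

end PartialAutSystem

theorem partialAutSystemsHaveJEP (F : Type*) [Field F] (n : ℕ) :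
    PartialAutSystemsHaveJEP.{u} F n := by
  intro A B
  choose a ha using fun i => (A.map i).exists_extension
  choose b hb using fun i => (B.map i).exists_extension
  exact ⟨.total (A.carrier × B.carrier) fun i => (a i).prodCongr (b i),
    ⟨A.embeddingTotal _ (LinearMap.inl F _ _) LinearMap.inl_injective fun i x => by simp [ha]⟩,
    ⟨B.embeddingTotal _ (LinearMap.inr F _ _) LinearMap.inr_injective fun i x => by simp [hb]⟩⟩

/-- `A'` is `A` with its maps made total. Over a total base, extending the maps of `B` and `C` to
automorphisms cannot create a conflict, so the pushout amalgamates them. -/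
theorem partialAutSystemsHaveWAP (F : Type*) [Field F] (n : ℕ) :
    PartialAutSystemsHaveWAP.{u} F n := by
  intro A
  choose a ha using fun i => (A.map i).exists_extension
  refine ⟨.total A.carrier a, A.embeddingTotal a LinearMap.id Function.injective_id ha,
    fun B C α β => ?_⟩
  choose b hb using fun i => (B.map i).exists_extension
  choose c hc using fun i => (C.map i).exists_extension
  obtain ⟨N, d, γ, δ, hγ, hδ, hγδ, hdγ, hdδ⟩ := exists_amalgam (A := A.carrier)
    α.toLinearMap β.toLinearMap α.injective β.injective (fun i => a i) b c
    (fun i x => (hb i ⟨_, α.mem_dom i ⟨x, trivial⟩⟩).trans (α.comm i ⟨x, trivial⟩))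
    (fun i x => (hc i ⟨_, β.mem_dom i ⟨x, trivial⟩⟩).trans (β.comm i ⟨x, trivial⟩))
  exact ⟨.total _ d, B.embeddingTotal d γ hγ fun i x => by rw [hdγ, hb],
    C.embeddingTotal d δ hδ fun i x => by rw [hdδ, hc], hγδ⟩

/-! ### The Polish topology on the automorphism group -/

section Topology

open Topology

attribute [local instance] linearAutTopology

variable {F : Type*} [Field F] {V : Type*} [AddCommGroup V] [Module F V]

theorem isOpen_setOf_linearEquiv_apply_eq (x y : V) : IsOpen {g : V ≃ₗ[F] V | g x = y} := by
  let _ : TopologicalSpace V := ⊥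
  have : DiscreteTopology V := ⟨rfl⟩
  have h : Continuous fun g : V ≃ₗ[F] V => g x := (continuous_apply x).comp continuous_induced_dom
  exact (isOpen_discrete {y}).preimage h

theorem continuous_linearEquiv_iff {X : Type*} [TopologicalSpace X] {f : X → V ≃ₗ[F] V} :
    Continuous f ↔ ∀ x y, IsOpen {a | f a x = y} := by
  refine ⟨fun h x y => (isOpen_setOf_linearEquiv_apply_eq x y).preimage h, fun h => ?_⟩
  let _ : TopologicalSpace V := ⊥
  have : DiscreteTopology V := ⟨rfl⟩
  exact continuous_induced_rng.2 (continuous_pi fun x => continuous_discrete_rng.2 (h x))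

variable (F V) in
theorem isTopologicalGroup_linearEquiv : IsTopologicalGroup (V ≃ₗ[F] V) where
  continuous_mul := by
    refine continuous_linearEquiv_iff.2 fun x y => ?_
    have h : {p : (V ≃ₗ[F] V) × (V ≃ₗ[F] V) | (p.1 * p.2) x = y}
        = ⋃ z, {g : V ≃ₗ[F] V | g z = y} ×ˢ {g : V ≃ₗ[F] V | g x = z} := by
      ext p
      simp
    rw [h]
    exact isOpen_iUnion fun z => (isOpen_setOf_linearEquiv_apply_eq z y).prod
      (isOpen_setOf_linearEquiv_apply_eq x z)
  continuous_inv := by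
    refine continuous_linearEquiv_iff.2 fun x y => ?_
    have h : {g : V ≃ₗ[F] V | g⁻¹ x = y} = {g | g y = x} := by
      ext g
      exact g.symm_apply_eq.trans eq_comm
    rw [h]
    exact isOpen_setOf_linearEquiv_apply_eq y x

variable (F V) in
theorem polishSpace_linearEquiv [Countable V] : PolishSpace (V ≃ₗ[F] V) := by
  let _ : TopologicalSpace V := ⊥
  have : DiscreteTopology V := ⟨rfl⟩
  have : PolishSpace V := inferInstance
  -- The inverse is recorded too because bijectivity is not a closed condition on `g` alone, whereas
  -- being a pair of mutually inverse maps is.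
  let Φ : (V ≃ₗ[F] V) → (V → V) × (V → V) := fun g => (g, ⇑g⁻¹)
  have hcoe : Continuous fun g : V ≃ₗ[F] V => (g : V → V) := continuous_induced_dom
  have hΦ : Continuous Φ :=
    hcoe.prodMk (hcoe.comp (isTopologicalGroup_linearEquiv F V).continuous_inv)
  -- The first coordinate alone already induces the topology.
  have hind : IsInducing Φ := IsInducing.of_comp hΦ continuous_fst ⟨rfl⟩
  have hinj : Function.Injective Φ := fun g h hgh => DFunLike.coe_injective (congrArg Prod.fst hgh)
  have heval (x : V) : Continuous fun f : V → V => f x := continuous_apply x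
  have hcomp (x : V) : Continuous fun p : (V → V) × (V → V) => p.1 (p.2 x) := by
    refine continuous_discrete_rng.2 fun y => ?_
    have h : (fun p : (V → V) × (V → V) => p.1 (p.2 x)) ⁻¹' {y}
        = ⋃ z, ((fun f : V → V => f z) ⁻¹' {y}) ×ˢ ((fun f : V → V => f x) ⁻¹' {z}) := by
      ext p
      simp
    rw [h]
    exact isOpen_iUnion fun z => ((isOpen_discrete {y}).preimage (heval z)).prod
      ((isOpen_discrete {z}).preimage (heval x))
  have hcomp' (x : V) : Continuous fun p : (V → V) × (V → V) => p.2 (p.1 x) :=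
    (hcomp x).comp continuous_swap
  have hrange : Set.range Φ = {p | (∀ x y, p.1 (x + y) = p.1 x + p.1 y)
      ∧ (∀ (c : F) x, p.1 (c • x) = c • p.1 x) ∧ (∀ x, p.2 (p.1 x) = x)
      ∧ ∀ x, p.1 (p.2 x) = x} := by
    ext p
    constructor
    · rintro ⟨g, rfl⟩
      exact ⟨map_add g, map_smul g, g.symm_apply_apply, g.apply_symm_apply⟩
    · rintro ⟨h1, h2, h3, h4⟩
      exact ⟨⟨⟨⟨p.1, h1⟩, h2⟩, p.2, h3, h4⟩, rfl⟩
  have hclosed : IsClosed (Set.range Φ) := by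
    rw [hrange]
    simp only [Set.ofPred_and, Set.ofPred_forall]
    have hfst (x : V) : Continuous fun p : (V → V) × (V → V) => p.1 x :=
      (heval x).comp continuous_fst
    refine (isClosed_iInter fun x => isClosed_iInter fun y => ?_).inter
      ((isClosed_iInter fun c => isClosed_iInter fun x => ?_).inter
      ((isClosed_iInter fun x => ?_).inter (isClosed_iInter fun x => ?_)))
    · exact isClosed_eq (hfst _) ((hfst x).add (hfst y))
    · exact isClosed_eq (hfst _)
        ((continuous_of_discreteTopology (f := fun v : V => c • v)).comp (hfst x))
    · exact isClosed_eq (hcomp' x) continuous_const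
    · exact isClosed_eq (hcomp x) continuous_const
  exact IsClosedEmbedding.polishSpace (f := Φ) ⟨⟨hind, hinj⟩, hclosed⟩

variable {ι : Type*} [Finite ι]

/-- Tuples of automorphisms have as basic neighbourhoods the sets of tuples that agree with them on a
finite-dimensional subspace. -/
theorem isOpen_linearEquiv_pi_iff {O : Set (ι → V ≃ₗ[F] V)} :
    IsOpen O ↔ ∀ g ∈ O, ∃ W : Submodule F V, FiniteDimensional F W ∧
      ∀ h : ι → V ≃ₗ[F] V, (∀ i, ∀ x ∈ W, h i x = g i x) → h ∈ O := by
  constructor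
  · intro hO g hg
    obtain ⟨u, hu, huO⟩ := isOpen_pi_iff'.1 hO g hg
    have key (i : ι) : ∃ W : Submodule F V, FiniteDimensional F W ∧
        ∀ h : V ≃ₗ[F] V, (∀ x ∈ W, h x = g i x) → h ∈ u i := by
      let _ : TopologicalSpace V := ⊥
      obtain ⟨U, hU, hUu⟩ := isOpen_induced_iff.1 (hu i).1
      have hgU : (g i : V → V) ∈ U := by
        have := (hu i).2
        rwa [← hUu] at this
      obtain ⟨s, t, ht, htU⟩ := isOpen_pi_iff.1 hU _ hgU
      refine ⟨Submodule.span F s, FiniteDimensional.span_finset F s, fun h hh => ?_⟩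
      rw [← hUu]
      refine htU fun x hx => ?_
      simpa [hh x (Submodule.subset_span hx)] using (ht x hx).2
    choose W hW hWu using key
    refine ⟨⨆ i, W i, Submodule.finiteDimensional_iSup W, fun h hh => huO fun i _ => ?_⟩
    exact hWu i _ fun x hx => hh i x (Submodule.mem_iSup_of_mem i hx)
  · intro H
    refine isOpen_iff_mem_nhds.2 fun g hg => ?_
    obtain ⟨W, hW, hWO⟩ := H g hg
    obtain ⟨s, hs⟩ := (Submodule.fg_iff_finiteDimensional W).2 hW
    have hopen : IsOpen (⋂ i : ι, ⋂ x ∈ s, (fun h : ι → V ≃ₗ[F] V => h i) ⁻¹'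
        {k : V ≃ₗ[F] V | k x = g i x}) :=
      isOpen_iInter_of_finite fun i => isOpen_biInter_finset fun x _ =>
        (isOpen_setOf_linearEquiv_apply_eq x _).preimage (continuous_apply i)
    refine Filter.mem_of_superset (hopen.mem_nhds (by simp)) fun h hh => hWO h fun i => ?_
    simp only [Set.mem_iInter, Set.mem_preimage, Set.mem_ofPred_eq] at hh
    have := LinearMap.eqOn_span (f := (h i).toLinearMap) (g := (g i).toLinearMap) (hh i)
    rwa [hs] at this

theorem dense_linearEquiv_pi {O : Set (ι → V ≃ₗ[F] V)}
    (H : ∀ (g : ι → V ≃ₗ[F] V) (W : Submodule F V), FiniteDimensional F W →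
      ∃ h ∈ O, ∀ i, ∀ x ∈ W, h i x = g i x) : Dense O := by
  refine dense_iff_inter_open.2 fun U hU ⟨g, hg⟩ => ?_
  obtain ⟨W, hW, hWU⟩ := isOpen_linearEquiv_pi_iff.1 hU g hg
  obtain ⟨h, hO, hh⟩ := H g W hW
  exact ⟨h, hWU h hh, hO⟩

end Topology

/-! ### Generic tuples form a comeager set -/

section Generic

variable {F : Type*} [Field F] {V : Type*} [AddCommGroup V] [Module F V] {ι : Type*}

/-- Every vector lies in a finite-dimensional subspace that is invariant under all `g i`. -/
def IsLocallyFiniteTuple (g : ι → V ≃ₗ[F] V) : Prop :=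
  ∀ v : V, ∃ W : Submodule F V, FiniteDimensional F W ∧ v ∈ W ∧ ∀ i, ∀ x ∈ W, g i x ∈ W

/-- The map `φ₀`, restricted to the subspace `P` of `W`, intertwines `b` with `g`. -/
def IntertwinesOn {W : Type*} [AddCommGroup W] [Module F W] (g : ι → V ≃ₗ[F] V)
    (b : ι → W →ₗ[F] W) (P : Submodule F W) (φ₀ : W →ₗ[F] V) : Prop :=
  ∀ i, ∀ x ∈ P, φ₀ (b i x) = g i (φ₀ x)

/-- If `φ₀|P` intertwines `b` with `g`, then it extends to an intertwining embedding. -/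
def ExtendsIfIntertwines {W : Type*} [AddCommGroup W] [Module F W] (g : ι → V ≃ₗ[F] V)
    (b : ι → W →ₗ[F] W) (P : Submodule F W) (φ₀ : W →ₗ[F] V) : Prop :=
  IntertwinesOn g b P φ₀ → ∃ φ : W →ₗ[F] V, Function.Injective φ ∧
    (∀ i x, φ (b i x) = g i (φ x)) ∧ ∀ x ∈ P, φ x = φ₀ x

/-- Injectivity of `(V, g)` with respect to embeddings of finite-dimensional spaces with operators;
the spaces are realized as subspaces of `V`. -/
def HasExtensionProperty (g : ι → V ≃ₗ[F] V) : Prop :=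
  ∀ W : {W : Submodule F V // FiniteDimensional F W}, ∀ (b : ι → W.1 →ₗ[F] W.1)
    (P : Submodule F W.1) (φ₀ : W.1 →ₗ[F] V), (∀ i, Function.Injective (b i)) →
    (∀ i, ∀ x ∈ P, b i x ∈ P) → (∀ x ∈ P, φ₀ x = 0 → x = 0) → ExtendsIfIntertwines g b P φ₀

theorem countable_finiteDimensional_submodule [Countable V] :
    Countable {W : Submodule F V // FiniteDimensional F W} := by
  refine Function.Surjective.countable (f := fun s : Finset V =>
    (⟨Submodule.span F s, FiniteDimensional.span_finset F s⟩ :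
      {W : Submodule F V // FiniteDimensional F W})) ?_
  rintro ⟨W, hW⟩
  obtain ⟨s, hs⟩ := (Submodule.fg_iff_finiteDimensional W).2 hW
  exact ⟨s, Subtype.ext hs⟩

theorem countable_submodule (W : Type*) [AddCommGroup W] [Module F W] [FiniteDimensional F W]
    [Countable W] : Countable (Submodule F W) :=
  have := countable_finiteDimensional_submodule (F := F) (V := W)
  Function.Injective.countable
    (f := fun P => (⟨P, inferInstance⟩ : {P : Submodule F W // FiniteDimensional F P}))
    fun _ _ h => congrArg Subtype.val h

theorem countable_linearMap (W : Type*) [AddCommGroup W] [Module F W] [FiniteDimensional F W]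
    [Countable V] : Countable (W →ₗ[F] V) :=
  ((Module.finBasis F W).constr ℕ (M' := V)).symm.injective.countable

/-- A tuple can be modified outside of a finite-dimensional subspace so as to leave a larger
finite-dimensional subspace invariant. -/
theorem exists_agree_invariant [Finite ι] (g : ι → V ≃ₗ[F] V) (W : Submodule F V)
    [FiniteDimensional F W] :
    ∃ (h : ι → V ≃ₗ[F] V) (W' : Submodule F V), FiniteDimensional F W' ∧ W ≤ W' ∧
      (∀ i, ∀ x ∈ W', h i x ∈ W') ∧ ∀ i, ∀ x ∈ W, h i x = g i x := by
  -- Each `g i` maps `W` into `W'`. This partial map extends to an automorphism of `W'`, and then to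
  -- one of `V`.
  let W' : Submodule F V := W ⊔ ⨆ i, W.map (g i).toLinearMap
  have hle : W ≤ W' := le_sup_left
  have hmem (i : ι) (x : W) : g i x ∈ W' :=
    (le_iSup (fun i => W.map (g i).toLinearMap) i).trans le_sup_right ⟨x, x.2, rfl⟩
  have hfin : FiniteDimensional F W' := inferInstance
  choose d hd using fun i => exists_linearEquiv_comp_eq (Submodule.inclusion hle)
    (((g i).toLinearMap ∘ₗ W.subtype).codRestrict W' (hmem i)) (Submodule.inclusion_injective hle)
    (fun x y hxy => Subtype.ext ((g i).injective (congrArg Subtype.val hxy)))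
  choose h hh using fun i => exists_linearEquiv_extending_conj W'.subtype W'.injective_subtype (d i)
  refine ⟨h, W', hfin, hle, fun i x hx => ?_, fun i x hx => ?_⟩
  · have := hh i ⟨x, hx⟩
    simp only [Submodule.subtype_apply] at this
    rw [this]
    exact (d i _).2
  · exact (hh i ⟨x, hle hx⟩).trans (congrArg Subtype.val (hd i ⟨x, hx⟩))

/-- Density of a single extension requirement: amalgamate `(W, b)` over `P` with a
finite-dimensional invariant piece of `V` containing `U` and `φ₀(P)`, then realize the amalgam
inside `V`, which has room because it is infinite-dimensional. -/
theorem exists_agree_extends [Finite ι] (hV : ¬ FiniteDimensional F V) (g : ι → V ≃ₗ[F] V)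
    (U : Submodule F V) [FiniteDimensional F U] {W : Type*} [AddCommGroup W] [Module F W]
    [FiniteDimensional F W] (b : ι → W →ₗ[F] W) (P : Submodule F W) (φ₀ : W →ₗ[F] V)
    (hb : ∀ i, Function.Injective (b i)) (hbP : ∀ i, ∀ x ∈ P, b i x ∈ P)
    (hφ₀ : ∀ x ∈ P, φ₀ x = 0 → x = 0) :
    ∃ h : ι → V ≃ₗ[F] V, ExtendsIfIntertwines h b P φ₀ ∧ ∀ i, ∀ x ∈ U, h i x = g i x := by
  by_cases hg : IntertwinesOn g b P φ₀
  swap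
  -- If `φ₀` does not intertwine on `P`, the requirement holds vacuously for `g` itself.
  · exact ⟨g, fun h => absurd h hg, fun _ _ _ => rfl⟩
  obtain ⟨h, W', hW', hle, hinv, hagree⟩ := exists_agree_invariant g (U ⊔ P.map φ₀)
  have hφP (x : P) : φ₀ x ∈ U ⊔ P.map φ₀ := (le_sup_right : P.map φ₀ ≤ _) ⟨x, x.2, rfl⟩
  let α : P →ₗ[F] W' := (φ₀ ∘ₗ P.subtype).codRestrict W' fun x => hle (hφP x)
  have hα : Function.Injective α := (injective_iff_map_eq_zero α).2 fun x hx =>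
    Subtype.ext (hφ₀ x x.2 (congrArg Subtype.val hx))
  let c (i : ι) : W' ≃ₗ[F] W' := LinearEquiv.ofInjectiveEndo
    ((h i).toLinearMap.restrict (hinv i))
    fun x y hxy => Subtype.ext ((h i).injective (congrArg Subtype.val hxy))
  have hc (i : ι) (x : W') : (c i x : V) = h i x := rfl
  obtain ⟨N, d, γ, δ, hγ, hδ, hγδ, hdγ, hdδ⟩ := exists_amalgam α P.subtype hα P.injective_subtype
    (fun i x => ⟨b i x, hbP i x x.2⟩) c (fun i => LinearEquiv.ofInjectiveEndo (b i) (hb i))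
    (fun i x => Subtype.ext (((hc i _).trans (hagree i _ (hφP x))).trans (hg i x x.2).symm))
    (fun i x => rfl)
  -- `ψ` fixes `W'` pointwise, so the transported operators still agree with `g` on `U`.
  obtain ⟨ψ, hψ, hψγ⟩ := exists_injective_comp_eq hV γ W'.subtype hγ W'.injective_subtype
  choose k hk using fun i => exists_linearEquiv_extending_conj ψ hψ (d i)
  refine ⟨k, fun _ => ⟨ψ ∘ₗ δ, hψ.comp hδ, fun i x => ?_, fun x hx => ?_⟩, fun i x hx => ?_⟩
  · exact (congrArg ψ (hdδ i x)).symm.trans (hk i (δ x)).symm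
  · exact (congrArg ψ (hγδ ⟨x, hx⟩)).symm.trans (hψγ _)
  · have hxU : x ∈ U ⊔ P.map φ₀ := (le_sup_left : U ≤ _) hx
    have h1 : ψ (γ ⟨x, hle hxU⟩) = x := hψγ _
    calc k i x = ψ (d i (γ ⟨x, hle hxU⟩)) := by rw [← hk, h1]
      _ = g i x := by rw [hdγ, hψγ, Submodule.subtype_apply, hc, hagree i x hxU]

attribute [local instance] linearAutTopology

theorem isLocallyFiniteTuple_mem_residual [Finite ι] [Countable V] :
    {g : ι → V ≃ₗ[F] V | IsLocallyFiniteTuple g} ∈ residual (ι → V ≃ₗ[F] V) := by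
  refine (eventually_countable_forall (l := residual (ι → V ≃ₗ[F] V))).2 fun v => ?_
  refine residual_of_dense_open (isOpen_linearEquiv_pi_iff.2 ?_) (dense_linearEquiv_pi ?_)
  · rintro g ⟨W, hW, hv, hinv⟩
    exact ⟨W, hW, fun h hh => ⟨W, hW, hv, fun i x hx => hh i x hx ▸ hinv i x hx⟩⟩
  · intro g W hW
    obtain ⟨h, W', hW', hle, hinv, hh⟩ := exists_agree_invariant g (W ⊔ F ∙ v)
    exact ⟨h, ⟨W', hW', hle (Submodule.mem_sup_right (Submodule.mem_span_singleton_self v)), hinv⟩,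
      fun i x hx => hh i x (Submodule.mem_sup_left hx)⟩

theorem hasExtensionProperty_mem_residual [Finite ι] [Countable V] (hV : ¬ FiniteDimensional F V) :
    {g : ι → V ≃ₗ[F] V | HasExtensionProperty g} ∈ residual (ι → V ≃ₗ[F] V) := by
  have := countable_finiteDimensional_submodule (F := F) (V := V)
  refine (eventually_countable_forall (l := residual (ι → V ≃ₗ[F] V))).2 fun ⟨W, hW⟩ => ?_
  have := countable_submodule (F := F) W
  have := countable_linearMap (F := F) (V := V) W
  have := countable_linearMap (F := F) (V := W) W
  refine eventually_countable_forall.2 fun b => eventually_countable_forall.2 fun P =>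
    eventually_countable_forall.2 fun φ₀ => ?_
  -- The conditions on `b`, `P`, `φ₀` do not involve the tuple, so they move outside the quantifier
  -- "for generic `g`".
  simp only [Filter.eventually_imp_distrib_left]
  intro hb hbP hφ₀
  refine residual_of_dense_open (isOpen_linearEquiv_pi_iff.2 fun g hg => ?_)
    (dense_linearEquiv_pi fun g U hU => exists_agree_extends hV g U b P φ₀ hb hbP hφ₀)
  by_cases hgP : IntertwinesOn g b P φ₀
  · obtain ⟨φ, hφ, hφg, hφP⟩ := hg hgP
    -- A tuple agreeing with `g` on the range of `φ` is intertwined by the same `φ`.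
    refine ⟨LinearMap.range φ, inferInstance, fun h hh _ => ⟨φ, hφ, fun i x => ?_, hφP⟩⟩
    rw [hφg, hh i _ ⟨x, rfl⟩]
  · simp only [IntertwinesOn, not_forall] at hgP
    obtain ⟨i, x, hx, hne⟩ := hgP
    -- The failure at `x` depends only on the value of `g i` at `φ₀ x`, so it persists nearby.
    refine ⟨F ∙ φ₀ x, inferInstance, fun h hh hhP => absurd (hhP i x hx) ?_⟩
    rwa [hh i _ (Submodule.mem_span_singleton_self _)]

end Generic

/-! ### Conjugacy of generic tuples by back-and-forth -/

section BackAndForth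

variable {F : Type*} [Field F] {V : Type*} [AddCommGroup V] [Module F V] {ι : Type*}

/-- `Γ` is the graph of an isomorphism between finite-dimensional subspaces of `(V, g)` and `(V, h)`
that are invariant under the operators. -/
structure IsPartialIsoGraph (g h : ι → V ≃ₗ[F] V) (Γ : Submodule F (V × V)) : Prop where
  finiteDimensional : FiniteDimensional F Γ
  invariant : ∀ i, ∀ p ∈ Γ, (g i p.1, h i p.2) ∈ Γ
  snd_eq_zero : ∀ p ∈ Γ, p.1 = 0 → p.2 = 0
  fst_eq_zero : ∀ p ∈ Γ, p.2 = 0 → p.1 = 0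

theorem IsPartialIsoGraph.swap {g h : ι → V ≃ₗ[F] V} {Γ : Submodule F (V × V)}
    (hΓ : IsPartialIsoGraph g h Γ) :
    IsPartialIsoGraph h g (Γ.map (LinearEquiv.prodComm F V V).toLinearMap) where
  finiteDimensional := have := hΓ.finiteDimensional; inferInstance
  invariant := by
    rintro i _ ⟨p, hp, rfl⟩
    exact ⟨_, hΓ.invariant i p hp, rfl⟩
  snd_eq_zero := by
    rintro _ ⟨p, hp, rfl⟩
    exact hΓ.fst_eq_zero p hp
  fst_eq_zero := by
    rintro _ ⟨p, hp, rfl⟩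
    exact hΓ.snd_eq_zero p hp

theorem IsLocallyFiniteTuple.exists_invariant {g : ι → V ≃ₗ[F] V} (hg : IsLocallyFiniteTuple g)
    (U : Submodule F V) [hU : FiniteDimensional F U] :
    ∃ W : Submodule F V, FiniteDimensional F W ∧ U ≤ W ∧ ∀ i, ∀ x ∈ W, g i x ∈ W := by
  obtain ⟨s, rfl⟩ := (Submodule.fg_iff_finiteDimensional U).2 hU
  choose W hW hmem hinv using hg
  refine ⟨⨆ v : s, W v, inferInstance, Submodule.span_le.2 fun v hv =>
    Submodule.mem_iSup_of_mem (⟨v, hv⟩ : s) (hmem v), fun i => ?_⟩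
  exact (iSup_le fun v x hx => Submodule.mem_iSup_of_mem v (hinv v i x hx) :
    (⨆ v : s, W v) ≤ (⨆ v : s, W v).comap (g i).toLinearMap)

/-- The forth step: local finiteness of `g` encloses `v` and the domain of `Γ` in a
finite-dimensional invariant subspace, and the extension property of `h` extends the partial
isomorphism to it. Applied to swapped graphs, it gives the back step. -/
theorem IsPartialIsoGraph.exists_extension {g h : ι → V ≃ₗ[F] V} (hg : IsLocallyFiniteTuple g)
    (hh : HasExtensionProperty h) {Γ : Submodule F (V × V)} (hΓ : IsPartialIsoGraph g h Γ) (v : V) :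
    ∃ Γ', IsPartialIsoGraph g h Γ' ∧ Γ ≤ Γ' ∧ ∃ y, (v, y) ∈ Γ' := by
  have := hΓ.finiteDimensional
  obtain ⟨W, hW, hle, hinv⟩ :=
    hg.exists_invariant (Γ.map (LinearMap.fst F V V) ⊔ F ∙ v)
  have hfst (p : Γ) : p.1.1 ∈ W := hle (Submodule.mem_sup_left ⟨p, p.2, rfl⟩)
  have hv : v ∈ W := hle (Submodule.mem_sup_right (Submodule.mem_span_singleton_self v))
  let f : Γ →ₗ[F] W := (LinearMap.fst F V V ∘ₗ Γ.subtype).codRestrict W hfst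
  have hf : LinearMap.ker f = ⊥ := LinearMap.ker_eq_bot'.2 fun p hp => by
    have h1 : p.1.1 = 0 := congrArg Subtype.val hp
    exact Subtype.ext (Prod.ext h1 (hΓ.snd_eq_zero p p.2 h1))
  -- The extension property takes `φ₀` defined on all of `W`. The left inverse `r` provides such a
  -- map, and only its values on the range of `f` matter.
  obtain ⟨r, hr⟩ := f.exists_leftInverse_of_injective hf
  have hrf (p : Γ) : r (f p) = p := LinearMap.congr_fun hr p
  let φ₀ : W →ₗ[F] V := LinearMap.snd F V V ∘ₗ Γ.subtype ∘ₗ r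
  have hφ₀ (p : Γ) : φ₀ (f p) = p.1.2 := by simp [φ₀, hrf]
  let b (i : ι) : W →ₗ[F] W := (g i).toLinearMap.restrict (hinv i)
  have hb (i : ι) (p : Γ) : b i (f p) = f ⟨_, hΓ.invariant i p p.2⟩ := rfl
  obtain ⟨φ, hφ, hφh, hφφ₀⟩ := hh ⟨W, hW⟩ b (LinearMap.range f) φ₀
    (fun i x y hxy => Subtype.ext ((g i).injective (congrArg Subtype.val hxy)))
    (by rintro i _ ⟨p, rfl⟩; exact ⟨_, (hb i p).symm⟩)
    (by
      rintro _ ⟨p, rfl⟩ hp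
      rw [hφ₀] at hp
      exact Subtype.ext (hΓ.fst_eq_zero p p.2 hp))
    (by rintro i _ ⟨p, rfl⟩; rw [hb, hφ₀, hφ₀])
  refine ⟨LinearMap.range (W.subtype.prod φ), ⟨inferInstance, ?_, ?_, ?_⟩, fun p hp => ?_,
    φ ⟨v, hv⟩, ⟨v, hv⟩, rfl⟩
  · rintro i _ ⟨x, rfl⟩
    exact ⟨b i x, Prod.ext rfl (hφh i x)⟩
  · rintro _ ⟨x, rfl⟩ hx
    have : x = 0 := Subtype.ext hx
    simp [this]
  · rintro _ ⟨x, rfl⟩ hx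
    have : x = 0 := (injective_iff_map_eq_zero φ).1 hφ x hx
    simp [this]
  · exact ⟨f ⟨p, hp⟩, Prod.ext rfl ((hφφ₀ _ ⟨_, rfl⟩).trans (hφ₀ ⟨p, hp⟩))⟩

theorem exists_linearEquiv_conj [Countable V] {g h : ι → V ≃ₗ[F] V}
    (hg : IsLocallyFiniteTuple g) (hg' : HasExtensionProperty g)
    (hh : IsLocallyFiniteTuple h) (hh' : HasExtensionProperty h) :
    ∃ k : V ≃ₗ[F] V, ∀ i x, k (g i x) = h i (k x) := by
  have : Encodable V := Encodable.ofCountable V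
  let Q := {Γ : Submodule F (V × V) // IsPartialIsoGraph g h Γ}
  let D : V ⊕ V → Order.Cofinal Q := Sum.elim
    (fun v => ⟨{Γ | ∃ y, (v, y) ∈ Γ.1}, fun Γ => by
      obtain ⟨Γ', hΓ', hle, hv⟩ := Γ.2.exists_extension hg hh' v
      exact ⟨⟨Γ', hΓ'⟩, hv, hle⟩⟩)
    (fun v => ⟨{Γ | ∃ x, (x, v) ∈ Γ.1}, fun Γ => by
      obtain ⟨Γ', hΓ', hle, x, hx⟩ := Γ.2.swap.exists_extension hh hg' v
      exact ⟨⟨_, hΓ'.swap⟩, ⟨x, (v, x), hx, rfl⟩,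
        fun p hp => ⟨p.swap, hle ⟨p, hp, rfl⟩, rfl⟩⟩⟩)
  -- Starting from the zero graph, the ideal meets countably many cofinal sets, which put every
  -- vector into the domain and into the range. The union `S` of its members is then the graph of an
  -- automorphism.
  let I : Order.Ideal Q := Order.idealOfCofinals
    ⟨⊥, inferInstance, by simp, by simp, by simp⟩ D
  have hdir : Directed (· ≤ ·) fun Γ : I => Γ.1.1 := fun Γ Γ' => by
    obtain ⟨Δ, hΔ, h1, h2⟩ := I.directed Γ.1 Γ.2 Γ'.1 Γ'.2
    exact ⟨⟨Δ, hΔ⟩, h1, h2⟩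
  have : Nonempty I := I.nonempty.to_subtype
  let S : Submodule F (V × V) := ⨆ Γ : I, Γ.1.1
  have hS {p : V × V} : p ∈ S ↔ ∃ Γ : I, p ∈ Γ.1.1 := Submodule.mem_iSup_of_directed _ hdir
  have hfst : Function.Bijective (LinearMap.fst F V V ∘ₗ S.subtype) := by
    refine ⟨(injective_iff_map_eq_zero _).2 fun p hp => ?_, fun v => ?_⟩
    · obtain ⟨Γ, hΓ⟩ := hS.1 p.2
      exact Subtype.ext (Prod.ext hp (Γ.1.2.snd_eq_zero _ hΓ hp))
    · obtain ⟨Γ, ⟨y, hy⟩, hΓ⟩ := Order.cofinal_meets_idealOfCofinals _ D (Sum.inl v)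
      exact ⟨⟨(v, y), hS.2 ⟨⟨Γ, hΓ⟩, hy⟩⟩, rfl⟩
  have hsnd : Function.Bijective (LinearMap.snd F V V ∘ₗ S.subtype) := by
    refine ⟨(injective_iff_map_eq_zero _).2 fun p hp => ?_, fun v => ?_⟩
    · obtain ⟨Γ, hΓ⟩ := hS.1 p.2
      exact Subtype.ext (Prod.ext (Γ.1.2.fst_eq_zero _ hΓ hp) hp)
    · obtain ⟨Γ, ⟨x, hx⟩, hΓ⟩ := Order.cofinal_meets_idealOfCofinals _ D (Sum.inr v)
      exact ⟨⟨(x, v), hS.2 ⟨⟨Γ, hΓ⟩, hx⟩⟩, rfl⟩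
  let k : V ≃ₗ[F] V := (LinearEquiv.ofBijective _ hfst).symm.trans (LinearEquiv.ofBijective _ hsnd)
  have hk (p : S) : k p.1.1 = p.1.2 :=
    congrArg (LinearMap.snd F V V ∘ₗ S.subtype)
      ((LinearEquiv.ofBijective _ hfst).symm_apply_apply p)
  refine ⟨k, fun i x => ?_⟩
  obtain ⟨p, rfl⟩ := hfst.2 x
  obtain ⟨Γ, hΓ⟩ := hS.1 p.2
  have h1 := hk ⟨_, hS.2 ⟨Γ, Γ.1.2.invariant i _ hΓ⟩⟩
  exact h1.trans (congrArg (h i) (hk p)).symm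

end BackAndForth

/-! ### Ample generics and the main theorem -/

theorem isPolishGroupWithAmpleGenerics_linearEquiv (F : Type*) [Field F] (V : Type*)
    [AddCommGroup V] [Module F V] [Countable V] (hV : ¬ FiniteDimensional F V) :
    IsPolishGroupWithAmpleGenerics (V ≃ₗ[F] V) (linearAutTopology F V) := by
  let _ := linearAutTopology F V
  have hpolish := polishSpace_linearEquiv F V
  refine ⟨isTopologicalGroup_linearEquiv F V, hpolish, fun n => ?_⟩
  have hres := Filter.inter_mem (isLocallyFiniteTuple_mem_residual (F := F) (V := V) (ι := Fin n))
    (hasExtensionProperty_mem_residual hV)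
  -- By the Baire category theorem the comeager set of generic tuples is nonempty, and all its
  -- members are conjugate to `g`.
  obtain ⟨g, hg, hg'⟩ := (dense_of_mem_residual hres).nonempty
  refine ⟨g, Filter.mem_of_superset hres fun h hh => ?_⟩
  obtain ⟨k, hk⟩ := exists_linearEquiv_conj hg hg' hh.1 hh.2
  refine ⟨k, funext fun i => LinearEquiv.ext fun x => ?_⟩
  exact ((hk i (k.symm x)).trans (congrArg (h i) (k.apply_symm_apply x))).symm

theorem mainTheorem5 :
    HasHrushovskiProperty.{u} ℚ ∧ HasHrushovskiProperty.{u} ℝ ∧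
    (∀ n : ℕ, PartialAutSystemsHaveJEP.{u} ℚ n ∧ PartialAutSystemsHaveWAP.{u} ℚ n) ∧
    (∀ (V : Type v) [AddCommGroup V] [Module ℚ V] [Countable V], ¬ FiniteDimensional ℚ V →
      IsPolishGroupWithAmpleGenerics (V ≃ₗ[ℚ] V) (linearAutTopology ℚ V)) :=
  ⟨hasHrushovskiProperty ℚ, hasHrushovskiProperty ℝ,
    fun n => ⟨partialAutSystemsHaveJEP ℚ n, partialAutSystemsHaveWAP ℚ n⟩,
    fun V _ _ _ hV => isPolishGroupWithAmpleGenerics_linearEquiv ℚ V hV⟩
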